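/- Let $\mathcal F=\mathrm{GL}(n,\mathbb C)/B$ be the variety of complete flags $0=V_0\subset V_1\subset\dots\subset V_n=\mathbb C^n$ ($\dim V_k=k$), where $B$ is the group of invertible upper triangular matrices, i.e. the stabilizer of the standard flag $F_0$ with $V_k=\langle\varepsilon_1,\dots,\varepsilon_k\rangle$. The symmetric group $S_n$ acts on $\mathbb C^n$ by $\varepsilon_i\mapsto\varepsilon_{w(i)}$, hence on $\mathcal F$. For $w\in S_n$ let the Schubert variety $\mathcal X_w$ be the closure in $\mathcal F$ of the Schubert cell $\mathcal C_w=B\cdot wF_0$. Use the coordinates $(x_{ij})_{i>j}$ on the open neighbourhood of $F_0$ consisting of the flags whose $V_k$ is spanned by the first $k$ columns of a lower unitriangular matrix with entries $x_{ij}$ below the diagonal ($F_0$ is the origin); they identify $T_{F_0}\mathcal F$ with $\mathbb C^{n(n-1)/2}$. Let the tangent cone $\mathcal T_w\subset T_{F_0}\mathcal F$ be the set of vectors tangent to $\mathcal X_w$ at $F_0$, that is, of all limits $\lim_m c_m d_m$ with $c_m\in\mathbb C$, $d_m\to 0$ and $d_m\in\mathcal X_w$ in these coordinates. Let $I_w\subset\mathbb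 C[x_{ij}]$ be the ideal of equations of the tangent cone, generated by the lowest-degree homogeneous parts of all polynomials that vanish on $\mathcal X_w$ in this chart. Then for every $n$ and every $w\in S_n$ the Schubert varieties $\mathcal X_w$ and $\mathcal X_{w^{-1}}$ have the same tangent cone at $F_0$: $\mathcal T_w=\mathcal T_{w^{-1}}$, and moreover $I_w=I_{w^{-1}}$. -/

import Mathlib

open scoped MatrixGroups

noncomputable section

namespace SchubertCone

/-- A complete flag `0 = V₀ ⊂ V₁ ⊂ ⋯ ⊂ Vₙ = ℂⁿ` with `dim V_k = k`. -/
@[ext]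
structure CompleteFlag (n : ℕ) where
  /-- the `k`-th subspace `V_k` of the flag -/
  space : Fin (n + 1) → Submodule ℂ (Fin n → ℂ)
  mono : Monotone space
  finrank_eq : ∀ k, Module.finrank ℂ (space k) = (k : ℕ)

variable {n : ℕ}

/-- The image of a flag under a linear automorphism of `ℂⁿ`. -/
def CompleteFlag.map (e : (Fin n → ℂ) ≃ₗ[ℂ] (Fin n → ℂ)) (F : CompleteFlag n) :
    CompleteFlag n where
  space k := (F.space k).map (e : (Fin n → ℂ) →ₗ[ℂ] (Fin n → ℂ))
  mono _ _ h := Submodule.map_mono (F.mono h)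
  finrank_eq k := by rw [LinearEquiv.finrank_map_eq, F.finrank_eq]

/-- `GL(n, ℂ)` acts on flags through its action on `ℂⁿ`. -/
instance : MulAction (GL (Fin n) ℂ) (CompleteFlag n) where
  smul g F := F.map (Matrix.GeneralLinearGroup.toLin g).toLinearEquiv
  one_smul F := by
    ext k v
    change v ∈ (F.space k).map _ ↔ _
    rw [Submodule.mem_map_equiv, map_one]
    rfl
  mul_smul g h F := by
    ext k v
    change v ∈ (F.space k).map _ ↔ v ∈ ((F.space k).map _).map _
    rw [Submodule.mem_map_equiv, Submodule.mem_map_equiv, Submodule.mem_map_equiv, map_mul]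
    rfl

/-- The symmetric group acts on `ℂⁿ` by permuting the standard basis, `ε_i ↦ ε_{w i}`
(that is, `(w v)_i = v_{w⁻¹ i}`), and hence on flags. -/
def permMap (w : Equiv.Perm (Fin n)) : (Fin n → ℂ) ≃ₗ[ℂ] (Fin n → ℂ) :=
  LinearEquiv.funCongrLeft ℂ ℂ w.symm

theorem permMap_single (w : Equiv.Perm (Fin n)) (i : Fin n) :
    permMap w (Pi.single i 1) = Pi.single (w i) 1 := by
  ext j
  simp [permMap, LinearEquiv.funCongrLeft_apply, LinearMap.funLeft_apply, Pi.single_apply,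
    Equiv.symm_apply_eq]

theorem finrank_flag_basisFun (k : Fin (n + 1)) :
    Module.finrank ℂ ((Pi.basisFun ℂ (Fin n)).flag k) = (k : ℕ) := by
  rw [Module.Basis.flag, finrank_span_set_eq_card
    ((Pi.basisFun ℂ (Fin n)).linearIndependent.linearIndepOn_id.mono (Set.image_subset_range _ _)),
    Set.toFinset_card, Set.card_image_of_injective _ (Pi.basisFun ℂ (Fin n)).injective]
  simp only [Fintype.card_subtype, Set.mem_ofPred_eq]
  rw [← Finset.card_map Fin.valEmbedding]
  trans (Finset.range k).card
  · congr 1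
    ext i
    simp only [Finset.mem_map, Finset.mem_filter, Finset.mem_univ, true_and,
      Fin.valEmbedding_apply, Finset.mem_range, Fin.lt_def, Fin.val_castSucc]
    exact ⟨fun ⟨a, ha, e⟩ => e ▸ ha, fun h => ⟨⟨i, by omega⟩, h, rfl⟩⟩
  · simp

/-- The standard flag `F₀`, whose `k`-th space is the span of the first `k` standard basis
vectors. -/
def stdFlag (n : ℕ) : CompleteFlag n where
  space k := (Pi.basisFun ℂ (Fin n)).flag k
  mono := (Pi.basisFun ℂ (Fin n)).flag_mono
  finrank_eq := finrank_flag_basisFun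

/-- The topology of the flag variety `GL(n, ℂ) / B`: the quotient topology for the orbit map
`g ↦ g F₀`. -/
instance : TopologicalSpace (CompleteFlag n) :=
  TopologicalSpace.coinduced (fun g : GL (Fin n) ℂ => g • stdFlag n) inferInstance

/-- The Borel subgroup of upper triangular matrices. -/
def borel (n : ℕ) : Subgroup (GL (Fin n) ℂ) where
  carrier := {g | (g : Matrix (Fin n) (Fin n) ℂ).BlockTriangular id}
  one_mem' := Matrix.blockTriangular_one
  mul_mem' ha hb := ha.mul hb
  inv_mem' {g} hg := by
    have : Invertible (g : Matrix (Fin n) (Fin n) ℂ) := g.isUnit.invertible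
    simpa using Matrix.blockTriangular_inv_of_blockTriangular hg

/-- The Schubert cell of `w`: the `B`-orbit of the flag `w F₀`. -/
def schubertCell (w : Equiv.Perm (Fin n)) : Set (CompleteFlag n) :=
  MulAction.orbit (borel n) ((stdFlag n).map (permMap w))

/-- The Schubert variety of `w`: the closure of the Schubert cell. -/
def schubertVariety (w : Equiv.Perm (Fin n)) : Set (CompleteFlag n) :=
  closure (schubertCell w)

/-- The positions `(i, j)` with `i > j`, which index the coordinates `x_{ij}`. -/
abbrev Pos (n : ℕ) : Type := {p : Fin n × Fin n // p.2 < p.1}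

/-- The lower unitriangular matrix with entries `x_{ij}` below the diagonal. -/
def unitriMatrix (x : Pos n → ℂ) : Matrix (Fin n) (Fin n) ℂ :=
  Matrix.of fun i j => if h : j < i then x ⟨(i, j), h⟩ else if i = j then 1 else 0

theorem det_unitriMatrix (x : Pos n → ℂ) : (unitriMatrix x).det = 1 := by
  rw [Matrix.det_of_isLowerTriangular]
  · simp [unitriMatrix]
  · intro i j hij
    have hij : i < j := hij
    simp [unitriMatrix, hij.not_gt, hij.ne]

/-- The flag with coordinates `x`: its `k`-th space is spanned by the first `k` columns of the
lower unitriangular matrix of `x`. The origin is `F₀`. -/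
def chartFlag (x : Pos n → ℂ) : CompleteFlag n :=
  Matrix.GeneralLinearGroup.mkOfDetNeZero (unitriMatrix x) (by simp [det_unitriMatrix]) • stdFlag n

/-- The Schubert variety of `w` in the affine chart `x ↦ chartFlag x` around `F₀`. -/
def localSchubert (w : Equiv.Perm (Fin n)) : Set (Pos n → ℂ) :=
  {x | chartFlag x ∈ schubertVariety w}

/-- The tangent cone of the Schubert variety of `w` at `F₀`, as a subset of the tangent space of the
flag variety at `F₀`, which the coordinates identify with `Pos n → ℂ`: the set of all limits of
`c_m d_m` with `c_m ∈ ℂ`, `d_m → 0`, and `d_m` in the Schubert variety. -/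
def tangentCone (w : Equiv.Perm (Fin n)) : Set (Pos n → ℂ) :=
  tangentConeAt ℂ (localSchubert w) 0

/-- The ideal of the lowest-degree homogeneous parts of the polynomials in an ideal `I`.
(The part of `f` of degree `d`, when those of degree less than `d` are zero, is the lowest-degree
part of `f`, or zero.) -/
def initialIdeal {σ : Type*} (I : Ideal (MvPolynomial σ ℂ)) : Ideal (MvPolynomial σ ℂ) :=
  Ideal.span {g | ∃ f ∈ I, ∃ d : ℕ,
    (∀ k < d, MvPolynomial.homogeneousComponent k f = 0) ∧
      g = MvPolynomial.homogeneousComponent d f}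

/-- The ideal of equations of the tangent cone of the Schubert variety of `w` at `F₀`: the
lowest-degree parts of all polynomials in the coordinates that vanish on the Schubert variety. -/
def tangentConeIdeal (w : Equiv.Perm (Fin n)) : Ideal (MvPolynomial (Pos n) ℂ) :=
  initialIdeal (MvPolynomial.vanishingIdeal ℂ (localSchubert w))

end SchubertCone

end

/-! Inversion of lower unitriangular matrices carries one Schubert variety to the other in the
chart. Indeed the preimage of `𝒳_w` under `g ↦ g F₀` is the closure of `B w B`, and inversion, a
homeomorphism of `GL(n, ℂ)`, sends this to the closure of `B w⁻¹ B`
(`inverseCoord_mem_localSchubert`). In coordinates, inversion is polynomial, fixes the origin and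
has linear part `-1`, since `(1 + N)⁻¹ = 1 - N + ⋯` (`inversePoly_add_X_mem`). Its derivative at the
origin only negates tangent vectors, and a lowest-degree part of degree `d` only changes by `(-1) ^
d`. Tangent cones and ideals are insensitive to such signs, so each inclusion holds, and replacing
`w` by `w⁻¹` reverses it. -/

noncomputable section

namespace SchubertCone

open Matrix MvPolynomial

/-! ### Polynomial substitutions with linear part `-1`. -/

section PolynomialSubstitution

variable {σ : Type*}

/-- A substitution whose linear part is `-1` acts on the degree `d` part of the graded ring of
the filtration by powers of the ideal of the origin as `(-1) ^ d`. -/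
theorem aeval_sub_neg_one_pow_mul_mem {φ : σ → MvPolynomial σ ℂ}
    (hφ : ∀ i, φ i + X i ∈ idealOfVars σ ℂ ^ 2) (d : ℕ) (f : MvPolynomial σ ℂ)
    (hf : f ∈ idealOfVars σ ℂ ^ d) :
    aeval φ f - (-1) ^ d * f ∈ idealOfVars σ ℂ ^ (d + 1) := by
  set M := idealOfVars σ ℂ with hM
  have hX : ∀ i, X i ∈ M := fun i => Ideal.subset_span ⟨i, rfl⟩
  have hφM : ∀ i, φ i ∈ M := fun i => by
    have h := M.sub_mem (Ideal.pow_le_self two_ne_zero (hφ i)) (hX i)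
    simpa using h
  have h0 : ∀ f : MvPolynomial σ ℂ, aeval φ f - f ∈ M := by
    intro f
    induction f using MvPolynomial.induction_on with
    | C a => simp [algebraMap_eq]
    | add p q hp hq => rw [map_add, add_sub_add_comm]; exact M.add_mem hp hq
    | mul_X p i _ =>
      rw [map_mul, aeval_X]
      exact M.sub_mem (M.mul_mem_left _ (hφM i)) (M.mul_mem_left _ (hX i))
  have h1 : ∀ f ∈ M, aeval φ f + f ∈ M ^ 2 := by
    intro f hf
    refine Submodule.span_induction ?_ (by simp) ?_ ?_ hf
    · rintro _ ⟨i, rfl⟩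
      simpa using hφ i
    · intro p q _ _ hp hq
      rw [map_add, add_add_add_comm]
      exact (M ^ 2).add_mem hp hq
    · intro c p hp' hp
      have e : aeval φ (c • p) + c • p = aeval φ c * (aeval φ p + p) - (aeval φ c - c) * p := by
        simp only [smul_eq_mul, map_mul]; ring
      rw [e]
      exact (M ^ 2).sub_mem ((M ^ 2).mul_mem_left _ hp) (sq M ▸ Ideal.mul_mem_mul (h0 c) hp')
  induction d generalizing f with
  | zero => simpa using h0 f
  | succ d ih =>
    rw [pow_succ'] at hf
    refine Submodule.mul_induction_on hf ?_ ?_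
    · intro a ha b hb
      -- Expansion from `φ(a) ≡ -a` mod `M ^ 2` and `φ(b) ≡ (-1) ^ d b` mod `M ^ (d + 1)`; every
      -- error term has order at least `d + 2`.
      have e : aeval φ (a * b) - (-1) ^ (d + 1) * (a * b) =
          (aeval φ a + a) * (aeval φ b - (-1) ^ d * b) + (aeval φ a + a) * ((-1) ^ d * b) -
            a * (aeval φ b - (-1) ^ d * b) := by
        rw [map_mul]; ring
      rw [e]
      have hb' := (M ^ d).mul_mem_left ((-1) ^ d) hb
      refine Ideal.sub_mem _ (Ideal.add_mem _ ?_ ?_) ?_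
      · have h := Ideal.mul_mem_mul (h1 a ha) (ih b hb)
        rw [← pow_add] at h
        exact Ideal.pow_le_pow_right (by omega) h
      · have h := Ideal.mul_mem_mul (h1 a ha) hb'
        rw [← pow_add] at h
        exact Ideal.pow_le_pow_right (by omega) h
      · rw [pow_succ' M (d + 1)]
        exact Ideal.mul_mem_mul ha (ih b hb)
    · intro p q hp hq
      have e : aeval φ (p + q) - (-1) ^ (d + 1) * (p + q) =
          (aeval φ p - (-1) ^ (d + 1) * p) + (aeval φ q - (-1) ^ (d + 1) * q) := by
        rw [map_add]; ring
      rw [e]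
      exact Ideal.add_mem _ hp hq

theorem homogeneousComponent_eq_zero_of_mem_pow {d k : ℕ} (hk : k < d) {f : MvPolynomial σ ℂ}
    (hf : f ∈ idealOfVars σ ℂ ^ d) : homogeneousComponent k f = 0 := by
  ext m
  rw [coeff_homogeneousComponent, coeff_zero]
  split_ifs with h
  · exact (mem_pow_idealOfVars_iff' d f).1 hf m (by omega)
  · rfl

theorem mem_pow_idealOfVars_of_homogeneousComponent {d : ℕ} {f : MvPolynomial σ ℂ}
    (hf : ∀ k < d, homogeneousComponent k f = 0) : f ∈ idealOfVars σ ℂ ^ d := by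
  rw [mem_pow_idealOfVars_iff']
  intro m hm
  have h := congrArg (coeff m) (hf _ hm)
  rwa [coeff_homogeneousComponent, if_pos rfl, coeff_zero] at h

/-- The lowest-degree part of `f` reappears, up to the unit `(-1) ^ d`, as that of the substituted
polynomial, which lies in `J`. -/
theorem initialIdeal_le_of_aeval_mem {φ : σ → MvPolynomial σ ℂ}
    (hφ : ∀ i, φ i + X i ∈ idealOfVars σ ℂ ^ 2) {I J : Ideal (MvPolynomial σ ℂ)}
    (hIJ : ∀ f ∈ I, aeval φ f ∈ J) : initialIdeal I ≤ initialIdeal J := by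
  rw [initialIdeal, Ideal.span_le]
  rintro _ ⟨f, hf, d, hd, rfl⟩
  have hfd := mem_pow_idealOfVars_of_homogeneousComponent hd
  have key := aeval_sub_neg_one_pow_mul_mem hφ d f hfd
  have hC : ((-1) ^ d : MvPolynomial σ ℂ) = C ((-1) ^ d) := by simp
  have hd' : homogeneousComponent d (aeval φ f) = C ((-1) ^ d) * homogeneousComponent d f := by
    have h := homogeneousComponent_eq_zero_of_mem_pow (Nat.lt_succ_self d) key
    rwa [map_sub, hC, homogeneousComponent_C_mul, sub_eq_zero] at h
  have hmem : homogeneousComponent d (aeval φ f) ∈ initialIdeal J := by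
    refine Ideal.subset_span ⟨_, hIJ f hf, d, fun k hk => ?_, rfl⟩
    refine homogeneousComponent_eq_zero_of_mem_pow hk ?_
    have h := Ideal.add_mem _ (Ideal.pow_le_pow_right (Nat.le_succ d) key)
      (Ideal.mul_mem_left _ ((-1) ^ d) hfd)
    simpa using h
  have h := Ideal.mul_mem_left _ (C ((-1) ^ d)) hmem
  rw [hd', ← mul_assoc, ← C_mul, ← mul_pow] at h
  simpa using h

theorem aeval_zero_eq_zero_of_mem {p : MvPolynomial σ ℂ} (hp : p ∈ idealOfVars σ ℂ) :
    aeval (0 : σ → ℂ) p = 0 := by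
  refine Submodule.span_induction ?_ (by simp) ?_ ?_ hp
  · rintro _ ⟨i, rfl⟩
    simp
  · intro p q _ _ hp hq
    rw [map_add, hp, hq, add_zero]
  · intro c p _ hp
    rw [smul_eq_mul, map_mul, hp, mul_zero]

variable [Fintype σ]

theorem differentiable_aeval (p : MvPolynomial σ ℂ) :
    Differentiable ℂ (fun x : σ → ℂ => aeval x p) := by
  induction p using MvPolynomial.induction_on with
  | C a => simp
  | add p q hp hq =>
    simp only [map_add]
    exact hp.add hq
  | mul_X p i hp =>
    simp only [map_mul, aeval_X]
    exact hp.mul (differentiable_apply i)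

theorem hasFDerivAt_aeval_of_mem_sq {p : MvPolynomial σ ℂ} (hp : p ∈ idealOfVars σ ℂ ^ 2) :
    HasFDerivAt (fun x : σ → ℂ => aeval x p) (0 : (σ → ℂ) →L[ℂ] ℂ) 0 := by
  rw [sq] at hp
  refine Submodule.mul_induction_on hp ?_ ?_
  · intro a ha b hb
    have h := (differentiable_aeval a 0).hasFDerivAt.mul (differentiable_aeval b 0).hasFDerivAt
    simp only [map_mul]
    refine h.congr_fderiv (ContinuousLinearMap.ext fun v => ?_)
    change aeval (0 : σ → ℂ) a * _ + aeval (0 : σ → ℂ) b * _ = 0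
    rw [aeval_zero_eq_zero_of_mem ha, aeval_zero_eq_zero_of_mem hb, zero_mul, zero_mul, add_zero]
  · intro p q hp hq
    simp only [map_add]
    exact (hp.add hq).congr_fderiv (add_zero _)

theorem hasFDerivAt_aeval_neg_id {φ : σ → MvPolynomial σ ℂ}
    (hφ : ∀ i, φ i + X i ∈ idealOfVars σ ℂ ^ 2) :
    HasFDerivAt (fun (x : σ → ℂ) i => aeval x (φ i)) (-ContinuousLinearMap.id ℂ (σ → ℂ)) 0 := by
  rw [hasFDerivAt_pi']
  intro i
  have h := (hasFDerivAt_aeval_of_mem_sq (hφ i)).sub (hasFDerivAt_apply (𝕜 := ℂ) i (0 : σ → ℂ))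
  refine (h.congr_fderiv ?_).congr_of_eventuallyEq ?_
  · ext; simp
  · exact Filter.Eventually.of_forall fun x => by simp

/-- The scalars `c_m` may be replaced by `-c_m`. -/
theorem neg_mem_tangentConeAt {E : Type*} [NormedAddCommGroup E] [NormedSpace ℂ E] {s : Set E}
    {x v : E} (hv : v ∈ tangentConeAt ℂ s x) : -v ∈ tangentConeAt ℂ s x := by
  obtain ⟨α, l, _, c, d, hd, hds, hcd⟩ := exists_fun_of_mem_tangentConeAt hv
  exact mem_tangentConeAt_of_seq l (fun a => -c a) d hd hds (by simpa using hcd.neg)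

theorem tangentConeAt_zero_subset_of_mapsTo {φ : σ → MvPolynomial σ ℂ}
    (hφ : ∀ i, φ i + X i ∈ idealOfVars σ ℂ ^ 2) {S T : Set (σ → ℂ)}
    (hST : ∀ x ∈ S, (fun i => aeval x (φ i)) ∈ T) :
    tangentConeAt ℂ S 0 ⊆ tangentConeAt ℂ T 0 := by
  intro v hv
  have hφ0 : (fun i => aeval (0 : σ → ℂ) (φ i)) = 0 := by
    funext i
    have h := aeval_zero_eq_zero_of_mem (Ideal.pow_le_self two_ne_zero (hφ i))
    simpa using h
  have h := (hasFDerivAt_aeval_neg_id hφ).hasFDerivWithinAt.mapsTo_tangent_cone (s := S) hv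
  rw [hφ0] at h
  have h' := neg_mem_tangentConeAt (tangentConeAt_mono (Set.image_subset_iff.2 hST) h)
  simpa using h'

end PolynomialSubstitution
variable {n : ℕ}

/-! ### Inversion of unitriangular matrices in coordinates. -/

section Inversion

/-- The generic lower unitriangular matrix. -/
def genericUnitri (n : ℕ) : Matrix (Fin n) (Fin n) (MvPolynomial (Pos n) ℂ) :=
  Matrix.of fun i j => if h : j < i then X ⟨(i, j), h⟩ else if i = j then 1 else 0

theorem map_genericUnitri (x : Pos n → ℂ) :
    (aeval x : MvPolynomial (Pos n) ℂ →ₐ[ℂ] ℂ).mapMatrix (genericUnitri n) = unitriMatrix x := by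
  ext i j
  simp only [genericUnitri, unitriMatrix, AlgHom.mapMatrix_apply, Matrix.map_apply, Matrix.of_apply]
  split_ifs <;> simp

theorem det_genericUnitri : (genericUnitri n).det = 1 := by
  rw [Matrix.det_of_isLowerTriangular]
  · simp [genericUnitri]
  · intro i j hij
    have hij : i < j := hij
    simp [genericUnitri, hij.not_gt, hij.ne]

/-- The entries of the inverse of the generic lower unitriangular matrix. -/
def inversePoly (p : Pos n) : MvPolynomial (Pos n) ℂ :=
  (genericUnitri n).adjugate p.1.1 p.1.2

/-- With `U = 1 + N` and inverse `A`, one has `A - 1 + N = -N (A - 1)`, and both factors have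
entries in the ideal of the origin. -/
theorem inversePoly_add_X_mem (p : Pos n) :
    inversePoly p + X p ∈ idealOfVars (Pos n) ℂ ^ 2 := by
  set M := idealOfVars (Pos n) ℂ
  set A := (genericUnitri n).adjugate with hA
  set N := genericUnitri n - 1 with hN
  have hNM : ∀ i j, N i j ∈ M := by
    intro i j
    simp only [hN, genericUnitri, Matrix.sub_apply, Matrix.of_apply, Matrix.one_apply]
    split_ifs with h h'
    · exact absurd h' h.ne'
    · rw [sub_zero]
      exact Ideal.subset_span (Set.mem_range_self _)
    all_goals simp
  -- As the determinant is `1`, the adjugate is a polynomial inverse.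
  have hUA : (1 + N) * A = 1 := by
    rw [hN, add_sub_cancel, hA, Matrix.mul_adjugate, det_genericUnitri, one_smul]
  have h1 : A - 1 = -(N * A) := by
    rw [add_mul, one_mul] at hUA
    rw [← hUA]; abel
  have h2 : A - 1 + N = -(N * (A - 1)) := by
    rw [mul_sub, mul_one, h1]; abel
  have hA1 : ∀ i j, (A - 1) i j ∈ M := by
    intro i j
    rw [h1, Matrix.neg_apply, Matrix.mul_apply]
    exact M.neg_mem (M.sum_mem fun k _ => M.mul_mem_right _ (hNM i k))
  have h3 : inversePoly p + X p = (A - 1 + N) p.1.1 p.1.2 := by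
    have hU : genericUnitri n p.1.1 p.1.2 = X p := dif_pos p.2
    rw [Matrix.add_apply, hN, Matrix.sub_apply, Matrix.sub_apply, hU, Matrix.one_apply_ne p.2.ne',
      sub_zero, sub_zero]
    rfl
  rw [h3, h2, Matrix.neg_apply, Matrix.mul_apply, sq]
  exact neg_mem (Ideal.sum_mem _ fun k _ => Ideal.mul_mem_mul (hNM _ k) (hA1 k _))

/-- The coordinates of the inverse of a lower unitriangular matrix. -/
def inverseCoord (x : Pos n → ℂ) (p : Pos n) : ℂ := aeval x (inversePoly p)

theorem inverseCoord_apply (x : Pos n → ℂ) (p : Pos n) :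
    inverseCoord x p = (unitriMatrix x)⁻¹ p.1.1 p.1.2 := by
  rw [inverseCoord, inversePoly, Matrix.inv_def, det_unitriMatrix, ← map_genericUnitri,
    ← AlgHom.map_adjugate]
  simp

theorem unitriMatrix_inverseCoord (x : Pos n → ℂ) :
    unitriMatrix (inverseCoord x) = (unitriMatrix x)⁻¹ := by
  have hdet : IsUnit (unitriMatrix x).det := by simp [det_unitriMatrix]
  have hL : (unitriMatrix x).BlockTriangular OrderDual.toDual := by
    intro i j hij
    have hij : i < j := hij
    simp [unitriMatrix, hij.not_gt, hij.ne]
  have := Matrix.invertibleOfIsUnitDet _ hdet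
  have hI := Matrix.blockTriangular_inv_of_blockTriangular hL
  ext i j
  rcases lt_trichotomy j i with h | h | h
  · simp [unitriMatrix, h, inverseCoord_apply]
  · subst h
    -- Both factors are lower triangular, so only the product of diagonal entries survives.
    have h1 := congrFun (congrFun (Matrix.mul_nonsing_inv _ hdet) j) j
    rw [Matrix.mul_apply, Finset.sum_eq_single j] at h1
    · simpa [unitriMatrix, eq_comm] using h1
    · intro k _ hk
      rcases lt_or_gt_of_ne hk with h | h
      · rw [hI (show OrderDual.toDual j < OrderDual.toDual k from h), mul_zero]
      · rw [hL (show OrderDual.toDual k < OrderDual.toDual j from h), zero_mul]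
    · simp
  · rw [hI (show OrderDual.toDual j < OrderDual.toDual i from h)]
    simp [unitriMatrix, h.not_gt, h.ne]

end Inversion

/-! ### Schubert varieties as closures of double cosets. -/

section Flags

theorem smul_space (g : GL (Fin n) ℂ) (F : CompleteFlag n) (k : Fin (n + 1)) :
    (g • F).space k = (F.space k).map (Matrix.mulVecLin (g : Matrix (Fin n) (Fin n) ℂ)) :=
  rfl

theorem mem_stdFlag_space (k : Fin (n + 1)) (v : Fin n → ℂ) :
    v ∈ (stdFlag n).space k ↔ ∀ i : Fin n, k ≤ i.castSucc → v i = 0 := by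
  change v ∈ Submodule.span ℂ _ ↔ _
  rw [Module.Basis.mem_span_image]
  simp only [Set.subset_def, Finset.mem_coe, Finsupp.mem_support_iff, Pi.basisFun_repr]
  refine forall_congr' fun i => ?_
  rw [← not_lt]
  exact not_imp_comm

theorem smul_stdFlag_eq_iff (g : GL (Fin n) ℂ) : g • stdFlag n = stdFlag n ↔ g ∈ borel n := by
  constructor
  · intro h i j hij
    have hij : j < i := hij
    have hj : Pi.single j 1 ∈ (stdFlag n).space j.succ := by
      rw [mem_stdFlag_space]
      intro k hk
      exact Pi.single_eq_of_ne (by rintro rfl; simp at hk) _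
    have hg : (g : Matrix (Fin n) (Fin n) ℂ).mulVecLin (Pi.single j 1) ∈
        (g • stdFlag n).space j.succ := by
      rw [smul_space]
      exact Submodule.mem_map_of_mem hj
    rw [h, mem_stdFlag_space] at hg
    simpa using hg i (by simpa [Fin.succ_le_castSucc_iff] using hij)
  · intro h
    have h : (g : Matrix (Fin n) (Fin n) ℂ).BlockTriangular id := h
    ext1
    funext k
    refine Submodule.eq_of_le_of_finrank_eq ?_ (by simp [CompleteFlag.finrank_eq])
    rw [smul_space]
    rintro _ ⟨v, hv, rfl⟩
    have hv := (mem_stdFlag_space k v).1 hv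
    rw [mem_stdFlag_space]
    intro i hi
    rw [Matrix.mulVecLin_apply, Matrix.mulVec, dotProduct]
    refine Finset.sum_eq_zero fun j _ => ?_
    rcases lt_or_ge j i with hj | hj
    · rw [h hj, zero_mul]
    · rw [hv j (hi.trans (Fin.castSucc_le_castSucc_iff.2 hj)), mul_zero]

theorem smul_stdFlag_eq_smul_iff (g h : GL (Fin n) ℂ) :
    g • stdFlag n = h • stdFlag n ↔ g⁻¹ * h ∈ borel n := by
  rw [← smul_stdFlag_eq_iff, mul_smul, inv_smul_eq_iff, eq_comm]

/-- The saturation of an open set is a union of right translates by the stabilizer `B`. -/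
theorem isOpenMap_smul_stdFlag :
    IsOpenMap (fun g : GL (Fin n) ℂ => g • stdFlag n) := by
  intro U hU
  rw [isOpen_coinduced]
  have e : (fun g : GL (Fin n) ℂ => g • stdFlag n) ⁻¹' ((fun g => g • stdFlag n) '' U) =
      ⋃ b ∈ borel n, (fun g => g * b) ⁻¹' U := by
    ext g
    simp only [Set.mem_preimage, Set.mem_image, Set.mem_iUnion, exists_prop]
    constructor
    · rintro ⟨u, hu, h⟩
      exact ⟨g⁻¹ * u, (smul_stdFlag_eq_smul_iff g u).1 h.symm, by simpa using hu⟩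
    · rintro ⟨b, hb, h⟩
      exact ⟨g * b, h, by rw [mul_smul, (smul_stdFlag_eq_iff b).2 hb]⟩
  rw [e]
  exact isOpen_biUnion fun b _ => hU.preimage (continuous_mul_const b)

theorem continuous_smul_stdFlag :
    Continuous (fun g : GL (Fin n) ℂ => g • stdFlag n) :=
  continuous_coinduced_rng

/-- The permutation matrix of `w`, with `ε_i ↦ ε_{w i}`. -/
def permGL (w : Equiv.Perm (Fin n)) : GL (Fin n) ℂ :=
  Matrix.GeneralLinearGroup.toLin.symm (LinearMap.GeneralLinearGroup.ofLinearEquiv (permMap w))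

theorem permGL_inv (w : Equiv.Perm (Fin n)) : permGL w⁻¹ = (permGL w)⁻¹ := by
  rw [permGL, permGL, ← map_inv, ← LinearMap.GeneralLinearGroup.ofLinearEquiv_inv]
  rfl

theorem permGL_smul (w : Equiv.Perm (Fin n)) (F : CompleteFlag n) :
    permGL w • F = F.map (permMap w) := by
  change F.map (Matrix.GeneralLinearGroup.toLin (permGL w)).toLinearEquiv = _
  rw [permGL, MulEquiv.apply_symm_apply]
  rfl

/-- The double coset `B w B`. -/
def bruhatCell (w : Equiv.Perm (Fin n)) : Set (GL (Fin n) ℂ) :=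
  {g | ∃ b ∈ borel n, ∃ c ∈ borel n, g = b * permGL w * c}

theorem preimage_schubertCell (w : Equiv.Perm (Fin n)) :
    (fun g : GL (Fin n) ℂ => g • stdFlag n) ⁻¹' schubertCell w = bruhatCell w := by
  ext g
  simp only [Set.mem_preimage, schubertCell, ← permGL_smul, bruhatCell, Set.mem_ofPred_eq]
  constructor
  · rintro ⟨⟨b, hb⟩, h⟩
    have h : (b * permGL w) • stdFlag n = g • stdFlag n := by rw [mul_smul]; exact h
    exact ⟨b, hb, _, (smul_stdFlag_eq_smul_iff _ _).1 h, by group⟩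
  · rintro ⟨b, hb, c, hc, rfl⟩
    refine ⟨⟨b, hb⟩, ?_⟩
    rw [mul_smul, (smul_stdFlag_eq_iff c).2 hc, mul_smul]
    rfl

theorem inv_bruhatCell (w : Equiv.Perm (Fin n)) : (bruhatCell w)⁻¹ = bruhatCell w⁻¹ := by
  ext g
  simp only [Set.mem_inv, bruhatCell, Set.mem_ofPred_eq, permGL_inv]
  constructor
  · rintro ⟨b, hb, c, hc, h⟩
    exact ⟨c⁻¹, inv_mem hc, b⁻¹, inv_mem hb, by rw [← inv_inv g, h]; group⟩
  · rintro ⟨b, hb, c, hc, rfl⟩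
    exact ⟨c⁻¹, inv_mem hc, b⁻¹, inv_mem hb, by group⟩

/-- Preimage under an open continuous map commutes with closure; this moves the problem to the
group, where inversion is available. -/
theorem smul_stdFlag_mem_schubertVariety (w : Equiv.Perm (Fin n)) (g : GL (Fin n) ℂ) :
    g • stdFlag n ∈ schubertVariety w ↔ g ∈ closure (bruhatCell w) := by
  rw [← preimage_schubertCell, ← isOpenMap_smul_stdFlag.preimage_closure_eq_closure_preimage
    continuous_smul_stdFlag]
  rfl

theorem inverseCoord_mem_localSchubert {w : Equiv.Perm (Fin n)} {x : Pos n → ℂ}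
    (hx : x ∈ localSchubert w) : inverseCoord x ∈ localSchubert w⁻¹ := by
  have hx := (smul_stdFlag_mem_schubertVariety w _).1 hx
  refine (smul_stdFlag_mem_schubertVariety w⁻¹ _).2 ?_
  rw [← inv_bruhatCell, ← inv_closure, Set.mem_inv]
  convert hx using 1
  rw [inv_eq_iff_eq_inv]
  apply Units.ext
  rw [Matrix.coe_units_inv]
  exact unitriMatrix_inverseCoord x

end Flags

theorem tangentCone_subset (w : Equiv.Perm (Fin n)) : tangentCone w ⊆ tangentCone w⁻¹ :=
  tangentConeAt_zero_subset_of_mapsTo inversePoly_add_X_mem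
    fun _ hx => inverseCoord_mem_localSchubert hx

/-- Contravariant: equations of `𝒳_{w⁻¹}` pull back along inversion to equations of `𝒳_w`. -/
theorem tangentConeIdeal_inv_le (w : Equiv.Perm (Fin n)) :
    tangentConeIdeal w⁻¹ ≤ tangentConeIdeal w := by
  refine initialIdeal_le_of_aeval_mem inversePoly_add_X_mem fun f hf x hx => ?_
  have h := hf _ (inverseCoord_mem_localSchubert hx)
  rwa [← AlgHom.comp_apply, comp_aeval]

end SchubertCone

end

theorem mainTheorem3 (n : ℕ) (w : Equiv.Perm (Fin n)) :
    SchubertCone.tangentCone w = SchubertCone.tangentCone w⁻¹ ∧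
      SchubertCone.tangentConeIdeal w = SchubertCone.tangentConeIdeal w⁻¹ := by
  refine ⟨(SchubertCone.tangentCone_subset w).antisymm ?_,
    le_antisymm ?_ (SchubertCone.tangentConeIdeal_inv_le w)⟩
  · simpa using SchubertCone.tangentCone_subset w⁻¹
  · simpa using SchubertCone.tangentConeIdeal_inv_le w⁻¹
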